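/- Let $L>0$, let $M\ge 0$ be an integer, $a_0,a_1,\dots,a_M\in\mathbb C$, and $s\in(0,\pi)$. For a function $u:\mathbb R\to\mathbb C$ the half Laplacian at $x\in\mathbb R$ is $$(-\Delta)^{1/2}u(x)=c_1\,\mathrm{p.v.}\!\int_{-\infty}^{\infty}\frac{u(x)-u(x+y)}{|y|^{2}}\,dy,\qquad c_\alpha=\alpha\frac{2^{\alpha-1}\Gamma(1/2+\alpha/2)}{\sqrt\pi\,\Gamma(1-\alpha/2)},\quad c_1=\frac1\pi ,$$ where the principal value is the limit as $\varepsilon\to0^+$ of the (absolutely convergent) integrals over $|y|>\varepsilon$. With the change of variable $x=L\cot(s)$, for an integer $k$, $(-\Delta)_s^{1/2}e^{iks}$ denotes the value at $x=L\cot(s)$ of $(-\Delta)^{1/2}$ applied to the function $x\mapsto e^{ik\operatorname{arccot}(x/L)}$, where $\operatorname{arccot}$ takes values in $(0,\pi)$. Let $P$ be any natural number with $P\ge 2M+1$, and let $\tilde b,\tilde c$ be the $P$-periodic sequences (indexed by $\mathbb Z$) given on $0\le l\le P-1$ by $$\tilde b_l=\begin{cases}(8l+4)a_l,&0\le l\le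 M,\\0,&M+1\le l\le P-1,\end{cases}$$ $$\tilde c_l=\begin{cases}\frac13,&l=0,\\0,&1\le l\le P-M-1,\\ \dfrac1{(2(l-P)-3)(2(l-P)-1)(2(l-P)+1)},&P-M\le l\le P-1,\end{cases}$$ with discrete convolution $(\tilde b\ast\tilde c)_l=\sum_{n=0}^{P-1}\tilde b_n\tilde c_{l-n}$. Then $(-\Delta)_s^{1/2}e^{-i(2l+1)s}$ exists (the principal value converges) for every $0\le l\le M$, and $$\sum_{l=0}^M a_l(-\Delta)_s^{1/2}e^{-i(2l+1)s}=\frac{2i}{L\pi}\sum_{l=0}^M\frac{a_l}{2l+3}-\frac{2i}{L\pi}\sum_{l=0}^M(\tilde b\ast\tilde c)_l\,e^{-2ils}$$ $$\qquad+\frac{2i}{L\pi}\Big(\cos(s)+\sin^2(s)\ln\big(\cot\tfrac s2\big)\Big)\sum_{l=0}^M(2l+1)a_l\,e^{-i(2l+1)s}.$$ -/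

import Mathlib

open Filter Topology MeasureTheory Set

noncomputable section

namespace HalfLaplacian

/-- The principal value integral of `f` over `ℝ`, with respect to the singularity `0`, converges
to `I`: `f` is integrable away from `0`, and the integrals over `|y| > ε` tend to `I`
as `ε` decreases to `0`. -/
def HasPVIntegral (f : ℝ → ℂ) (I : ℂ) : Prop :=
  (∀ ε : ℝ, 0 < ε → IntegrableOn f {y : ℝ | ε < |y|}) ∧
    Tendsto (fun ε : ℝ => ∫ y in {y : ℝ | ε < |y|}, f y) (𝓝[>] 0) (𝓝 I)

/-- The value of the principal value integral (meaningful when it converges). -/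
def pvIntegral (f : ℝ → ℂ) : ℂ :=
  limUnder (𝓝[>] (0 : ℝ)) (fun ε : ℝ => ∫ y in {y : ℝ | ε < |y|}, f y)

theorem HasPVIntegral.pvIntegral_eq {f : ℝ → ℂ} {I : ℂ} (h : HasPVIntegral f I) :
    pvIntegral f = I :=
  h.2.limUnder_eq

/-- The normalizing constant `c_α` of the fractional Laplacian of order `α`. -/
def fracLaplacianConst (α : ℝ) : ℝ :=
  α * (2 ^ (α - 1) * Real.Gamma (1 / 2 + α / 2)) / (√Real.pi * Real.Gamma (1 - α / 2))

/-- The integrand `y ↦ (u(x) - u(x + y)) / |y|^(1 + α)`. -/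
def fracLaplacianIntegrand (α : ℝ) (u : ℝ → ℂ) (x y : ℝ) : ℂ :=
  (u x - u (x + y)) / ((|y| ^ (1 + α) : ℝ) : ℂ)

/-- The fractional Laplacian of `u`, of order `α ∈ (0, 2)`, exists at the point `x`. -/
def FracLaplacianExistsAt (α : ℝ) (u : ℝ → ℂ) (x : ℝ) : Prop :=
  ∃ I : ℂ, HasPVIntegral (fracLaplacianIntegrand α u x) I

/-- The fractional Laplacian `(-Δ)^(α/2) u (x)` on `ℝ`, for `α ∈ (0, 2)`. -/
def fracLaplacian (α : ℝ) (u : ℝ → ℂ) (x : ℝ) : ℂ :=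
  (fracLaplacianConst α : ℂ) * pvIntegral (fracLaplacianIntegrand α u x)

/-- The inverse cotangent with values in `(0, π)`. -/
def arccot (x : ℝ) : ℝ := Real.pi / 2 - Real.arctan x

theorem arccot_mem_Ioo (x : ℝ) : arccot x ∈ Ioo 0 Real.pi := by
  unfold arccot
  constructor
  · linarith [Real.arctan_lt_pi_div_two x]
  · linarith [Real.neg_pi_div_two_lt_arctan x]

theorem cot_arccot (x : ℝ) : Real.cot (arccot x) = x := by
  rw [Real.cot_eq_cos_div_sin, arccot, Real.cos_pi_div_two_sub, Real.sin_pi_div_two_sub,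
    ← Real.tan_eq_sin_div_cos, Real.tan_arctan]

/-- The function of `x ∈ ℝ` obtained from a function `U` of `s ∈ (0, π)` by the change of
variable `x = L cot s`, that is `s = arccot (x / L)`. -/
def pullback (L : ℝ) (U : ℝ → ℂ) (x : ℝ) : ℂ := U (arccot (x / L))

/-- The half Laplacian `(-Δ)_s^(1/2) U (s)`: that of the function of `x` which corresponds to `U`,
at the point `x = L cot s`. -/
def halfLaplacianS (L : ℝ) (U : ℝ → ℂ) (s : ℝ) : ℂ :=
  fracLaplacian 1 (pullback L U) (L * Real.cot s)

/-- The half Laplacian `(-Δ)_s^(1/2) U (s)` exists. -/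
def HalfLaplacianSExistsAt (L : ℝ) (U : ℝ → ℂ) (s : ℝ) : Prop :=
  FracLaplacianExistsAt 1 (pullback L U) (L * Real.cot s)

/-- The function `s ↦ e^{iks}`. -/
def expFun (k : ℤ) (s : ℝ) : ℂ := Complex.exp (Complex.I * k * s)

/-- The discrete convolution of two `P`-periodic sequences. -/
def cyclicConv (P : ℕ) (b c : ℤ → ℂ) (l : ℤ) : ℂ :=
  ∑ n ∈ Finset.range P, b n * c (l - n)

/-- The `P`-periodic sequence that is `(8 l + 4) a_l` for `0 ≤ l ≤ M` and `0` for
`M + 1 ≤ l ≤ P - 1`; here `l % P` is the representative of `l` in `{0, …, P - 1}`. -/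
def bTilde (M P : ℕ) (a : ℕ → ℂ) (l : ℤ) : ℂ :=
  if l % P ≤ M then (8 * ((l % P : ℤ) : ℂ) + 4) * a (l % P).toNat else 0

/-- The values for `0 ≤ l ≤ P - 1` of the sequence `cTilde`. -/
def cTildeBase (M P : ℕ) (l : ℤ) : ℂ :=
  if l = 0 then 1 / 3
  else if l ≤ (P : ℤ) - M - 1 then 0
  else 1 / ((2 * ((l : ℂ) - P) - 3) * (2 * ((l : ℂ) - P) - 1) * (2 * ((l : ℂ) - P) + 1))

/-- The `P`-periodic extension of `cTildeBase`. -/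
def cTilde (M P : ℕ) (l : ℤ) : ℂ := cTildeBase M P (l % P)

end HalfLaplacian

end

namespace HalfLaplacian

/-! By linearity it suffices to treat one mode `k = 2n + 1`. Put `x + y = L cot (s + w)`. Then `y =
-L sin w / (sin s sin (s + w))`, so `dy / y² = -(sin² s / L) dw / sin² w`. The integrand becomes
`-(sin² s / L) e^{-iks} (1 - e^{-ikw}) / sin² w`, which has an elementary primitive in `w`.
Integration by parts reduces it to a primitive of `cot w · e^{-ikw}`. For odd `k` this is `log |tan
(w/2)|` plus an odd polynomial in `e^{-iw}` (`cotPoly`), as shown in `hasDerivAt_cotPoly`.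

Near `w = 0` the primitive is a function with a two-sided limit plus a logarithm whose values at
`±ε` differ by `o(1)` (`tendsto_linePrimitive_sub_neg`). The principal value is therefore the
difference of the limits at `y → ±∞`, that is at `w = -s` and `w = π - s`.

This difference contains `sin² s · cotPoly n (e^{is})`. Up to a constant, multiplying by `sin² s`
takes a second difference of the coefficients, and `1/(2j-1) - 2/(2j+1) + 1/(2j+3) =
8/((2j-1)(2j+1)(2j+3))`. This is the source of the entries of `cTilde`; `sum_closed_form` records
the identity with its end corrections. Summing over modes gives a triangular double sum, and the
condition `P ≥ 2M + 1` makes the cyclic convolution compute it without wraparound. -/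

/-! ### Principal values from primitives -/

theorem setOf_lt_abs_eq (ε : ℝ) : {y : ℝ | ε < |y|} = Iio (-ε) ∪ Ioi ε := by
  ext y
  simp only [mem_ofPred_eq, mem_union, mem_Iio, mem_Ioi, lt_abs]
  constructor
  · rintro (h | h)
    · exact Or.inr h
    · exact Or.inl (by linarith)
  · rintro (h | h)
    · exact Or.inr (by linarith)
    · exact Or.inl h

/-- A principal value integral computed from a primitive on the complement of the singularity. -/
theorem hasPVIntegral_of_hasDerivAt {f A : ℝ → ℂ} {a b : ℂ}
    (hf : ∀ ε : ℝ, 0 < ε → IntegrableOn f {y : ℝ | ε < |y|})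
    (hA : ∀ y : ℝ, y ≠ 0 → HasDerivAt A (f y) y)
    (ha : Tendsto A atTop (𝓝 a)) (hb : Tendsto A atBot (𝓝 b))
    (h0 : Tendsto (fun ε : ℝ => A ε - A (-ε)) (𝓝[>] 0) (𝓝 0)) :
    HasPVIntegral f (a - b) := by
  refine ⟨hf, ?_⟩
  have key : ∀ ε : ℝ, 0 < ε →
      ∫ y in {y : ℝ | ε < |y|}, f y = a - b - (A ε - A (-ε)) := by
    intro ε hε
    have hint := hf ε hε
    rw [setOf_lt_abs_eq] at hint ⊢
    have h1 : IntegrableOn f (Iio (-ε)) := hint.mono_set subset_union_left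
    have h2 : IntegrableOn f (Ioi ε) := hint.mono_set subset_union_right
    have hdisj : Disjoint (Iio (-ε)) (Ioi ε) := by
      rw [Set.disjoint_left]
      intro y hy hy'
      simp only [mem_Iio, mem_Ioi] at hy hy'
      linarith
    rw [setIntegral_union hdisj measurableSet_Ioi h1 h2, ← integral_Iic_eq_integral_Iio,
      integral_Iic_of_hasDerivAt_of_tendsto' (m := b) (f := A)
        (fun y hy => hA y (by simp only [mem_Iic] at hy; linarith))
        (by rwa [integrableOn_Iic_iff_integrableOn_Iio]) hb,
      integral_Ioi_of_hasDerivAt_of_tendsto' (m := a) (f := A)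
        (fun y hy => hA y (by simp only [mem_Ici] at hy; linarith)) h2 ha]
    ring
  have hlim : Tendsto (fun ε : ℝ => a - b - (A ε - A (-ε))) (𝓝[>] 0) (𝓝 (a - b)) := by
    simpa using h0.const_sub (a - b)
  refine hlim.congr' ?_
  filter_upwards [self_mem_nhdsWithin] with ε hε
  exact (key ε hε).symm

/-! ### The half Laplacian integrand -/

theorem fracLaplacianConst_one : fracLaplacianConst 1 = 1 / Real.pi := by
  unfold fracLaplacianConst
  have h : (1 : ℝ) / 2 + 1 / 2 = 1 := by norm_num
  have h' : (1 : ℝ) - 1 / 2 = 1 / 2 := by norm_num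
  rw [h, h', Real.Gamma_one, Real.Gamma_one_half_eq, Real.mul_self_sqrt Real.pi_pos.le]
  simp

theorem fracLaplacianIntegrand_one (u : ℝ → ℂ) (x y : ℝ) :
    fracLaplacianIntegrand 1 u x y = (u x - u (x + y)) / (y : ℂ) ^ 2 := by
  unfold fracLaplacianIntegrand
  rw [show (1 : ℝ) + 1 = (2 : ℕ) by norm_num, Real.rpow_natCast, sq_abs]
  push_cast
  rfl

/-- For a bounded continuous function, the integrand of the half Laplacian is integrable away
from the singularity. -/
theorem integrableOn_fracLaplacianIntegrand_one {u : ℝ → ℂ} (hu : Continuous u) {C : ℝ}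
    (hC : ∀ x, ‖u x‖ ≤ C) (x : ℝ) {ε : ℝ} (hε : 0 < ε) :
    IntegrableOn (fracLaplacianIntegrand 1 u x) {y : ℝ | ε < |y|} := by
  have hpow : IntegrableOn (fun y : ℝ => y ^ (-2 : ℝ)) (Ioi ε) :=
    integrableOn_Ioi_rpow_of_lt (by norm_num) hε
  have hsq : IntegrableOn (fun y : ℝ => (y ^ 2)⁻¹) (Ioi ε) := by
    refine hpow.congr_fun (fun y hy => ?_) measurableSet_Ioi
    have hy0 : 0 < y := hε.trans hy
    simp only
    rw [Real.rpow_neg hy0.le, ← Real.rpow_natCast y 2]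
    norm_num
  have hsq' : IntegrableOn (fun y : ℝ => (y ^ 2)⁻¹) (Iio (-ε)) := by
    have := IntegrableOn.comp_neg_Iio (c := -ε) (by rwa [neg_neg] : IntegrableOn (fun y : ℝ => (y ^ 2)⁻¹) (Ioi (- -ε)))
    simpa using this
  have hsqU : IntegrableOn (fun y : ℝ => 2 * C * (y ^ 2)⁻¹) {y : ℝ | ε < |y|} := by
    rw [setOf_lt_abs_eq]
    exact (hsq'.union hsq).const_mul _
  have hmeas : Measurable (fracLaplacianIntegrand 1 u x) := by
    have : fracLaplacianIntegrand 1 u x = fun y : ℝ => (u x - u (x + y)) / (y : ℂ) ^ 2 :=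
      funext (fracLaplacianIntegrand_one u x)
    rw [this]
    have h1 : Measurable fun y : ℝ => u x - u (x + y) := by
      have : Continuous fun y : ℝ => u x - u (x + y) := by fun_prop
      exact this.measurable
    exact h1.div (by fun_prop)
  refine Integrable.mono' hsqU hmeas.aestronglyMeasurable (Eventually.of_forall fun y => ?_)
  rw [fracLaplacianIntegrand_one, norm_div, norm_pow, Complex.norm_real, Real.norm_eq_abs, sq_abs,
    div_eq_mul_inv]
  refine mul_le_mul_of_nonneg_right ?_ (by positivity)
  calc ‖u x - u (x + y)‖ ≤ ‖u x‖ + ‖u (x + y)‖ := norm_sub_le _ _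
    _ ≤ 2 * C := by linarith [hC x, hC (x + y)]

/-! ### A primitive in the angle variable -/

/-- `e^{-iw}`. -/
noncomputable def expNeg (w : ℝ) : ℂ := Complex.exp (-(Complex.I * w))

theorem expNeg_eq (w : ℝ) :
    expNeg w = (Real.cos w : ℂ) - Complex.I * (Real.sin w : ℂ) := by
  rw [expNeg, show -(Complex.I * (w : ℂ)) = -(w : ℂ) * Complex.I by ring, Complex.exp_mul_I,
    Complex.cos_neg, Complex.sin_neg]
  push_cast
  ring

theorem expNeg_pow (w : ℝ) (k : ℕ) :
    expNeg w ^ k = Complex.exp (-(Complex.I * k * w)) := by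
  rw [expNeg, ← Complex.exp_nat_mul]
  congr 1
  ring

theorem hasDerivAt_expNeg_pow (k : ℕ) (w : ℝ) :
    HasDerivAt (fun w : ℝ => expNeg w ^ k) (-(Complex.I * k) * expNeg w ^ k) w := by
  simp only [expNeg_pow]
  have h : HasDerivAt (fun w : ℝ => -(Complex.I * k * (w : ℂ))) (-(Complex.I * k * 1)) w :=
    ((Complex.ofRealCLM.hasDerivAt (x := w)).const_mul (Complex.I * k)).neg
  convert h.cexp using 1
  ring

/-- The odd polynomial part of the primitive of `cot w · e^{-i(2n+1)w}`. -/
noncomputable def cotPoly (n : ℕ) (q : ℂ) : ℂ :=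
  q + ∑ m ∈ Finset.range n,
    (q ^ (2 * m + 1) / (2 * (m : ℂ) + 1) + q ^ (2 * m + 3) / (2 * (m : ℂ) + 3))

theorem cotPoly_zero (q : ℂ) : cotPoly 0 q = q := by simp [cotPoly]

theorem cotPoly_succ (n : ℕ) (q : ℂ) :
    cotPoly (n + 1) q = cotPoly n q +
      (q ^ (2 * n + 1) / (2 * (n : ℂ) + 1) + q ^ (2 * n + 3) / (2 * (n : ℂ) + 3)) := by
  rw [cotPoly, cotPoly, Finset.sum_range_succ, add_assoc]

theorem cotPoly_neg (n : ℕ) (q : ℂ) : cotPoly n (-q) = -cotPoly n q := by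
  induction n with
  | zero => simp [cotPoly_zero]
  | succ n ih =>
    rw [cotPoly_succ, cotPoly_succ, ih, Odd.neg_pow ⟨n, rfl⟩, Odd.neg_pow ⟨n + 1, by ring⟩]
    ring

theorem two_mul_natCast_add_one_ne_zero (n : ℕ) : (2 * (n : ℂ) + 1) ≠ 0 := by
  exact_mod_cast Nat.succ_ne_zero (2 * n)

theorem two_mul_natCast_add_three_ne_zero (n : ℕ) : (2 * (n : ℂ) + 3) ≠ 0 := by
  exact_mod_cast Nat.succ_ne_zero (2 * n + 2)

/-- Induction on `n`: with `q = e^{-iw}`, raising the exponent by two changes `cot w · q^(2n+1)` by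
`-i (q^(2n+1) + q^(2n+3))`, and `-i q^m` is the derivative of `q^m / m`. -/
theorem hasDerivAt_cotPoly (n : ℕ) {w : ℝ} (hw : Real.sin w ≠ 0) :
    HasDerivAt (fun w : ℝ => cotPoly n (expNeg w))
      ((Real.cos w : ℂ) / (Real.sin w : ℂ) * expNeg w ^ (2 * n + 1) - 1 / (Real.sin w : ℂ)) w := by
  have hw' : (Real.sin w : ℂ) ≠ 0 := by exact_mod_cast hw
  have hcs : (Real.cos w : ℂ) ^ 2 + (Real.sin w : ℂ) ^ 2 = 1 := by
    exact_mod_cast Real.cos_sq_add_sin_sq w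
  have hq := expNeg_eq w
  induction n with
  | zero =>
    simp only [cotPoly_zero]
    have h := hasDerivAt_expNeg_pow 1 w
    simp only [pow_one] at h
    convert h using 1
    rw [hq]
    field_simp
    linear_combination (norm := ring_nf) hcs
    simp only [Complex.I_sq]
    ring
  | succ n ih =>
    simp only [cotPoly_succ]
    have h1 := (hasDerivAt_expNeg_pow (2 * n + 1) w).div_const (2 * (n : ℂ) + 1)
    have h2 := (hasDerivAt_expNeg_pow (2 * n + 3) w).div_const (2 * (n : ℂ) + 3)
    refine (ih.add (h1.add h2)).congr_deriv ?_
    have e1 : (-(Complex.I * ((2 * n + 1 : ℕ) : ℂ)) * expNeg w ^ (2 * n + 1)) / (2 * (n : ℂ) + 1)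
        = -Complex.I * expNeg w ^ (2 * n + 1) := by
      have := two_mul_natCast_add_one_ne_zero n
      push_cast
      field_simp
    have e2 : (-(Complex.I * ((2 * n + 3 : ℕ) : ℂ)) * expNeg w ^ (2 * n + 3)) / (2 * (n : ℂ) + 3)
        = -Complex.I * expNeg w ^ (2 * n + 3) := by
      have := two_mul_natCast_add_three_ne_zero n
      push_cast
      field_simp
    -- This is `cot w = i (1 + q²) / (1 - q²)` with denominators cleared.
    have key : (Real.cos w : ℂ) * (expNeg w ^ 2 - 1)
        = -Complex.I * (Real.sin w : ℂ) * (1 + expNeg w ^ 2) := by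
      rw [hq]
      linear_combination (norm := ring_nf) (Real.cos w - Complex.I * Real.sin w : ℂ) * hcs
      simp only [Complex.I_sq, Complex.I_pow_three]
      ring
    rw [e1, e2, show 2 * (n + 1) + 1 = 2 * n + 1 + 2 by ring,
      show 2 * n + 3 = 2 * n + 1 + 2 by ring, pow_add]
    field_simp
    linear_combination (-expNeg w ^ (2 * n + 1)) * key

/-- Both signs of `tan (w / 2)` are covered because `Real.log` is `log |·|`; one formula thus serves
on both sides of the singularity. -/
theorem hasDerivAt_log_tan_half {w : ℝ} (hw : Real.sin w ≠ 0) :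
    HasDerivAt (fun w : ℝ => Real.log (Real.tan (w / 2))) (1 / Real.sin w) w := by
  have hsin : Real.sin w = 2 * Real.sin (w / 2) * Real.cos (w / 2) := by
    rw [← Real.sin_two_mul]; congr 1; ring
  rw [hsin] at hw ⊢
  have hs : Real.sin (w / 2) ≠ 0 := fun h => hw (by rw [h]; ring)
  have hc : Real.cos (w / 2) ≠ 0 := fun h => hw (by rw [h]; ring)
  have ht : Real.tan (w / 2) ≠ 0 := by
    rw [Real.tan_eq_sin_div_cos]; exact div_ne_zero hs hc
  have h : HasDerivAt (fun w : ℝ => Real.tan (w / 2)) (1 / Real.cos (w / 2) ^ 2 * (1 / 2)) w :=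
    HasDerivAt.comp (h := fun w : ℝ => w / 2) w (Real.hasDerivAt_tan hc)
      ((hasDerivAt_id w).div_const 2)
  refine (h.log ht).congr_deriv ?_
  rw [Real.tan_eq_sin_div_cos]
  field_simp

theorem hasDerivAt_cos_div_sin {w : ℝ} (hw : Real.sin w ≠ 0) :
    HasDerivAt (fun w : ℝ => Real.cos w / Real.sin w) (-1 / Real.sin w ^ 2) w := by
  refine ((Real.hasDerivAt_cos w).div (Real.hasDerivAt_sin w) hw).congr_deriv ?_
  rw [div_left_inj' (pow_ne_zero 2 hw)]
  linarith [Real.sin_sq_add_cos_sq w]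

/-- The part of `circlePrimitive` that extends continuously to `w = 0`. -/
noncomputable def circlePrimitiveReg (n : ℕ) (w : ℝ) : ℂ :=
  -((Real.cos w / Real.sin w : ℝ) : ℂ) * (1 - expNeg w ^ (2 * n + 1))
    + Complex.I * (2 * n + 1) * cotPoly n (expNeg w)

/-- A primitive of `(1 - e^{-i(2n+1)w}) / sin² w`. -/
noncomputable def circlePrimitive (n : ℕ) (w : ℝ) : ℂ :=
  circlePrimitiveReg n w + Complex.I * (2 * n + 1) * (Real.log (Real.tan (w / 2)) : ℝ)

/-- Integration by parts against `-cot w` leaves `i(2n+1)` times a primitive of `cot w ·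
e^{-i(2n+1)w}`; the `1 / sin w` missing from `cotPoly` is supplied by the logarithm. -/
theorem hasDerivAt_circlePrimitive (n : ℕ) {w : ℝ} (hw : Real.sin w ≠ 0) :
    HasDerivAt (circlePrimitive n)
      ((1 - expNeg w ^ (2 * n + 1)) / (Real.sin w : ℂ) ^ 2) w := by
  have hw' : (Real.sin w : ℂ) ≠ 0 := by exact_mod_cast hw
  have h1 := (hasDerivAt_cos_div_sin hw).ofReal_comp.neg
  have h2 := (hasDerivAt_expNeg_pow (2 * n + 1) w).const_sub 1
  have h3 := (hasDerivAt_cotPoly n hw).const_mul (Complex.I * (2 * (n : ℂ) + 1))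
  have h4 := (hasDerivAt_log_tan_half hw).ofReal_comp.const_mul (Complex.I * (2 * (n : ℂ) + 1))
  refine (((h1.mul h2).add h3).add h4).congr_deriv ?_
  simp only [Pi.neg_apply]
  push_cast
  push_cast at hw'
  field_simp
  ring

/-! ### Behaviour at the singularity -/

/-- The simple pole of `cot w` meets the simple zero of `1 - e^{-i(2n+1)w}`; both are expressed
through difference quotients at `0`. -/
theorem tendsto_circlePrimitiveReg_zero (n : ℕ) :
    ∃ c : ℂ, Tendsto (circlePrimitiveReg n) (𝓝[≠] 0) (𝓝 c) := by
  have h1 : Tendsto (fun w : ℝ => (w⁻¹ : ℝ) • (1 - expNeg w ^ (2 * n + 1))) (𝓝[≠] 0)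
      (𝓝 (-(-(Complex.I * ((2 * n + 1 : ℕ) : ℂ)) * expNeg 0 ^ (2 * n + 1)))) := by
    have := ((hasDerivAt_expNeg_pow (2 * n + 1) 0).const_sub 1).tendsto_slope_zero
    simpa [expNeg] using this
  have h2 : Tendsto (fun w : ℝ => (w⁻¹ : ℝ) • Real.sin w) (𝓝[≠] 0) (𝓝 1) := by
    simpa using (Real.hasDerivAt_sin 0).tendsto_slope_zero
  have h3 : Tendsto (fun w : ℝ => (((w⁻¹ : ℝ) • Real.sin w)⁻¹ * Real.cos w : ℝ)) (𝓝[≠] 0)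
      (𝓝 (1⁻¹ * Real.cos 0)) :=
    (h2.inv₀ one_ne_zero).mul (Real.continuous_cos.continuousAt.tendsto.mono_left nhdsWithin_le_nhds)
  have h4 : Tendsto (fun w : ℝ => ((((w⁻¹ : ℝ) • Real.sin w)⁻¹ * Real.cos w : ℝ) : ℂ)) (𝓝[≠] 0)
      (𝓝 ((1⁻¹ * Real.cos 0 : ℝ) : ℂ)) :=
    (Complex.continuous_ofReal.tendsto _).comp h3
  have h5 : Tendsto (fun w : ℝ => Complex.I * (2 * (n : ℂ) + 1) * cotPoly n (expNeg w)) (𝓝[≠] 0)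
      (𝓝 (Complex.I * (2 * (n : ℂ) + 1) * cotPoly n (expNeg 0))) := by
    have : Continuous fun w : ℝ => Complex.I * (2 * (n : ℂ) + 1) * cotPoly n (expNeg w) := by
      unfold cotPoly expNeg
      fun_prop
    exact this.continuousAt.tendsto.mono_left nhdsWithin_le_nhds
  refine ⟨_, ((h4.neg.mul h1).add h5).congr' ?_⟩
  filter_upwards [self_mem_nhdsWithin] with w hw
  have hw' : (w : ℂ) ≠ 0 := by exact_mod_cast hw
  simp only [circlePrimitiveReg, smul_eq_mul, Complex.real_smul]
  push_cast
  congr 1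
  rw [mul_inv, inv_inv]
  field_simp

theorem tendsto_neg_nhdsGT_nhdsNE :
    Tendsto (fun ε : ℝ => -ε) (𝓝[>] 0) (𝓝[≠] 0) := by
  refine tendsto_nhdsWithin_iff.2 ⟨?_, ?_⟩
  · have : Tendsto (fun ε : ℝ => -ε) (𝓝 0) (𝓝 (-0)) := continuous_neg.tendsto 0
    rw [neg_zero] at this
    exact this.mono_left nhdsWithin_le_nhds
  · filter_upwards [self_mem_nhdsWithin] with ε hε
    simp only [mem_compl_iff, mem_singleton_iff, neg_eq_zero]
    exact ne_of_gt hε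

/-- If `h` vanishes to first order at `0`, then `log |h(ε)| - log |h(-ε)|` tends to `0`. -/
theorem tendsto_log_sub_log_neg {h : ℝ → ℝ} {d : ℝ} (hd : HasDerivAt h d 0) (h0 : h 0 = 0)
    (hd0 : d ≠ 0) :
    Tendsto (fun ε : ℝ => Real.log (h ε) - Real.log (h (-ε))) (𝓝[>] 0) (𝓝 0) := by
  have hs : Tendsto (fun t : ℝ => t⁻¹ * h t) (𝓝[≠] 0) (𝓝 d) := by
    simpa [h0] using hd.tendsto_slope_zero
  have hl : Tendsto (fun t : ℝ => Real.log (t⁻¹ * h t)) (𝓝[≠] 0) (𝓝 (Real.log d)) :=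
    (Real.continuousAt_log hd0).tendsto.comp hs
  have hp : Tendsto (fun ε : ℝ => ε) (𝓝[>] 0) (𝓝[≠] 0) :=
    tendsto_id.mono_left (nhdsWithin_mono _ fun x hx => ne_of_gt hx)
  have hm := tendsto_neg_nhdsGT_nhdsNE
  -- Nonvanishing of the quotient makes both factors nonzero, so the logarithm splits; the terms
  -- `log ε⁻¹` and `log (-ε)⁻¹` then agree and cancel.
  have hne : ∀ᶠ t in 𝓝[≠] (0 : ℝ), t⁻¹ * h t ≠ 0 := hs.eventually_ne hd0
  have := (hl.comp hp).sub (hl.comp hm)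
  rw [sub_self] at this
  refine this.congr' ?_
  filter_upwards [hp.eventually hne, hm.eventually hne] with ε h1 h2
  simp only [Function.comp]
  rw [Real.log_mul (left_ne_zero_of_mul h1) (right_ne_zero_of_mul h1),
    Real.log_mul (left_ne_zero_of_mul h2) (right_ne_zero_of_mul h2), inv_neg, Real.log_neg_eq_log]
  ring

/-! ### Second-difference identity for the coefficients -/

/-- The closed form of the sums that occur in the half Laplacian of `e^{-i(2n+1)s}`. -/
theorem sum_closed_form (n : ℕ) {z : ℂ} (hz : z ≠ 0) :
    ∑ j ∈ Finset.range (n + 1),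
        4 * z ^ (2 * j + 1) / ((2 * (j : ℂ) - 1) * (2 * j + 1) * (2 * j + 3)) =
      -(z ^ 2 - (z ^ 2)⁻¹) * z ^ (2 * n + 1) / (4 * (2 * n + 1))
        + (z ^ 2 - 2 + (z ^ 2)⁻¹) * cotPoly n z / 4
        - z ^ (2 * n + 1) / ((2 * n + 1) * (2 * n + 3)) - (z + z⁻¹) / 2 := by
  induction n with
  | zero =>
    simp only [zero_add, Finset.range_one, Finset.sum_singleton, cotPoly_zero]
    push_cast
    field_simp
    ring
  | succ n ih =>
    have h1 := two_mul_natCast_add_one_ne_zero n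
    have h3 := two_mul_natCast_add_three_ne_zero n
    have h5 : (2 * (n : ℂ) + 5) ≠ 0 := by exact_mod_cast Nat.succ_ne_zero (2 * n + 4)
    rw [Finset.sum_range_succ, ih, cotPoly_succ]
    push_cast
    rw [show 2 * ((n : ℂ) + 1) - 1 = 2 * n + 1 by ring, show 2 * ((n : ℂ) + 1) + 1 = 2 * n + 3 by ring,
      show 2 * ((n : ℂ) + 1) + 3 = 2 * n + 5 by ring,
      show 2 * (n + 1) + 1 = 2 * n + 1 + 2 by ring, show 2 * n + 3 = 2 * n + 1 + 2 by ring, pow_add]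
    field_simp
    ring

/-! ### The change of variable -/

theorem arccot_cot {s : ℝ} (hs : s ∈ Ioo 0 Real.pi) : arccot (Real.cot s) = s := by
  have h : Real.cot s = Real.tan (Real.pi / 2 - s) := by
    rw [Real.tan_pi_div_two_sub, Real.tan_inv_eq_cot]
  rw [arccot, h, Real.arctan_tan (by linarith [hs.2]) (by linarith [hs.1])]
  ring

theorem hasDerivAt_arccot (x : ℝ) : HasDerivAt arccot (-Real.sin (arccot x) ^ 2) x := by
  have h := (Real.hasDerivAt_arctan x).const_sub (Real.pi / 2)
  refine h.congr_deriv ?_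
  rw [arccot, Real.sin_pi_div_two_sub, Real.cos_sq_arctan]

theorem tendsto_arccot_atTop : Tendsto arccot atTop (𝓝 0) := by
  have := (Real.tendsto_arctan_atTop.mono_right nhdsWithin_le_nhds).const_sub (Real.pi / 2)
  rwa [sub_self] at this

theorem tendsto_arccot_atBot : Tendsto arccot atBot (𝓝 Real.pi) := by
  have := (Real.tendsto_arctan_atBot.mono_right nhdsWithin_le_nhds).const_sub (Real.pi / 2)
  rwa [show Real.pi / 2 - -(Real.pi / 2) = Real.pi by ring] at this

theorem expFun_eq_expNeg_pow (l : ℕ) (s : ℝ) :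
    expFun (-(2 * (l : ℤ) + 1)) s = expNeg s ^ (2 * l + 1) := by
  rw [expFun, expNeg_pow]
  congr 1
  push_cast
  ring

theorem expNeg_add (a b : ℝ) : expNeg (a + b) = expNeg a * expNeg b := by
  rw [expNeg, expNeg, expNeg, ← Complex.exp_add]
  congr 1
  push_cast
  ring

theorem norm_expNeg (w : ℝ) : ‖expNeg w‖ = 1 := by
  rw [expNeg, show -(Complex.I * (w : ℂ)) = ((-w : ℝ) : ℂ) * Complex.I by push_cast; ring,
    Complex.norm_exp_ofReal_mul_I]

theorem continuous_arccot : Continuous arccot :=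
  continuous_iff_continuousAt.2 fun x => (hasDerivAt_arccot x).continuousAt

/-- The angle `t - s`, where `L cot t = L cot s + y`. -/
noncomputable def angleShift (L s y : ℝ) : ℝ := arccot ((L * Real.cot s + y) / L) - s

theorem angleShift_zero {L s : ℝ} (hL : L ≠ 0) (hs : s ∈ Ioo 0 Real.pi) :
    angleShift L s 0 = 0 := by
  rw [angleShift, add_zero, mul_div_cancel_left₀ _ hL, arccot_cot hs, sub_self]

theorem hasDerivAt_angleShift (L s y : ℝ) :
    HasDerivAt (angleShift L s) (-Real.sin (s + angleShift L s y) ^ 2 / L) y := by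
  have h1 : HasDerivAt (fun y : ℝ => (L * Real.cot s + y) / L) (1 / L) y :=
    ((hasDerivAt_id y).const_add _).div_const L
  refine (((hasDerivAt_arccot _).comp y h1).sub_const s).congr_deriv ?_
  rw [angleShift, add_sub_cancel]
  ring

theorem sin_add_angleShift_pos (L s y : ℝ) : 0 < Real.sin (s + angleShift L s y) := by
  rw [angleShift, add_sub_cancel]
  exact Real.sin_pos_of_mem_Ioo (arccot_mem_Ioo _)

/-- This is `cot t - cot s = -sin (t - s) / (sin t sin s)` with `t = s + w`. Squared, it turns `1 /
y²` into `1 / sin² w`. -/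
theorem sin_angleShift {L s : ℝ} (hL : L ≠ 0) (hs : s ∈ Ioo 0 Real.pi) (y : ℝ) :
    L * Real.sin (angleShift L s y) = -y * Real.sin s * Real.sin (s + angleShift L s y) := by
  have hss : Real.sin s ≠ 0 := (Real.sin_pos_of_mem_Ioo hs).ne'
  have hst := (sin_add_angleShift_pos L s y).ne'
  have hc := cot_arccot ((L * Real.cot s + y) / L)
  rw [angleShift, add_sub_cancel] at *
  set t := arccot ((L * Real.cot s + y) / L)
  rw [Real.cot_eq_cos_div_sin, Real.cot_eq_cos_div_sin] at hc
  rw [Real.sin_sub]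
  field_simp at hc
  linear_combination (-1) * hc

theorem sin_angleShift_ne_zero {L s y : ℝ} (hL : L ≠ 0) (hs : s ∈ Ioo 0 Real.pi) (hy : y ≠ 0) :
    Real.sin (angleShift L s y) ≠ 0 := by
  intro h
  have := sin_angleShift hL hs y
  rw [h, mul_zero, eq_comm] at this
  exact mul_ne_zero (mul_ne_zero (neg_ne_zero.2 hy) (Real.sin_pos_of_mem_Ioo hs).ne')
    (sin_add_angleShift_pos L s y).ne' this

theorem fracLaplacianIntegrand_one_pullback {L s : ℝ} (hL : L ≠ 0) (hs : s ∈ Ioo 0 Real.pi)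
    (n : ℕ) (y : ℝ) :
    fracLaplacianIntegrand 1 (pullback L (expFun (-(2 * (n : ℤ) + 1)))) (L * Real.cot s) y =
      expNeg s ^ (2 * n + 1) * (1 - expNeg (angleShift L s y) ^ (2 * n + 1)) / (y : ℂ) ^ 2 := by
  rw [fracLaplacianIntegrand_one, pullback, pullback, mul_div_cancel_left₀ _ hL, arccot_cot hs,
    expFun_eq_expNeg_pow, expFun_eq_expNeg_pow]
  have : arccot ((L * Real.cot s + y) / L) = s + angleShift L s y := by
    rw [angleShift, add_sub_cancel]
  rw [this, expNeg_add, mul_pow]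
  ring

/-! ### The primitive on the line and the principal value -/

/-- A primitive of the integrand of the half Laplacian of `e^{-i(2n+1)s}`. -/
noncomputable def linePrimitive (L s : ℝ) (n : ℕ) (y : ℝ) : ℂ :=
  -((Real.sin s : ℂ) ^ 2 / L) * expNeg s ^ (2 * n + 1) * circlePrimitive n (angleShift L s y)

theorem hasDerivAt_linePrimitive {L s y : ℝ} (hL : L ≠ 0) (hs : s ∈ Ioo 0 Real.pi) (n : ℕ)
    (hy : y ≠ 0) :
    HasDerivAt (linePrimitive L s n)
      (fracLaplacianIntegrand 1 (pullback L (expFun (-(2 * (n : ℤ) + 1)))) (L * Real.cot s) y)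
      y := by
  have hw := sin_angleShift_ne_zero hL hs hy
  have h := ((hasDerivAt_circlePrimitive n hw).scomp y (hasDerivAt_angleShift L s y)).const_mul
    (-((Real.sin s : ℂ) ^ 2 / L) * expNeg s ^ (2 * n + 1))
  refine h.congr_deriv ?_
  rw [fracLaplacianIntegrand_one_pullback hL hs, Complex.real_smul]
  have hsin : (L : ℂ) * (Real.sin (angleShift L s y) : ℂ)
      = -y * (Real.sin s : ℂ) * (Real.sin (s + angleShift L s y) : ℂ) := by
    exact_mod_cast sin_angleShift hL hs y
  have hw' : (Real.sin (angleShift L s y) : ℂ) ≠ 0 := by exact_mod_cast hw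
  have hL' : (L : ℂ) ≠ 0 := by exact_mod_cast hL
  have hy' : (y : ℂ) ≠ 0 := by exact_mod_cast hy
  push_cast [-Complex.ofReal_sin]
  generalize (Real.sin (angleShift L s y) : ℂ) = S at *
  generalize (Real.sin (s + angleShift L s y) : ℂ) = T at *
  generalize (Real.sin s : ℂ) = R at *
  generalize 1 - expNeg (angleShift L s y) ^ (2 * n + 1) = Q
  generalize expNeg s ^ (2 * n + 1) = E
  field_simp
  -- The goal is the squared form of `hsin`; the factor `L S - y R T` comes from the difference of
  -- squares.
  linear_combination (-(E * Q)) * (L * S - y * R * T) * hsin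

theorem tendsto_linePrimitive {L s : ℝ} (n : ℕ) {f : Filter ℝ} {t : ℝ}
    (hf : Tendsto (fun y => arccot ((L * Real.cot s + y) / L)) f (𝓝 t))
    (ht : Real.sin (t - s) ≠ 0) :
    Tendsto (linePrimitive L s n) f
      (𝓝 (-((Real.sin s : ℂ) ^ 2 / L) * expNeg s ^ (2 * n + 1) * circlePrimitive n (t - s))) :=
  ((hasDerivAt_circlePrimitive n ht).continuousAt.tendsto.comp (hf.sub_const s)).const_mul _

/-- The regular part has the same limit from both sides. The map `y ↦ tan (w / 2)` vanishes at `y =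
0` with nonzero derivative, so the logarithms at `ε` and `-ε` cancel in the limit. -/
theorem tendsto_linePrimitive_sub_neg {L s : ℝ} (hL : L ≠ 0) (hs : s ∈ Ioo 0 Real.pi) (n : ℕ) :
    Tendsto (fun ε : ℝ => linePrimitive L s n ε - linePrimitive L s n (-ε)) (𝓝[>] 0) (𝓝 0) := by
  have hw0 := angleShift_zero hL hs
  have hd := hasDerivAt_angleShift L s 0
  have hne : -Real.sin (s + angleShift L s 0) ^ 2 / L ≠ 0 :=
    div_ne_zero (neg_ne_zero.2 (pow_ne_zero 2 (sin_add_angleShift_pos L s 0).ne')) hL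
  have hw : Tendsto (angleShift L s) (𝓝[≠] 0) (𝓝[≠] 0) := by
    have := hd.tendsto_nhdsNE hne
    rwa [hw0] at this
  obtain ⟨c, hc⟩ := tendsto_circlePrimitiveReg_zero n
  have hp : Tendsto (fun ε : ℝ => ε) (𝓝[>] 0) (𝓝[≠] 0) :=
    tendsto_id.mono_left (nhdsWithin_mono _ fun x hx => ne_of_gt hx)
  have hm := tendsto_neg_nhdsGT_nhdsNE
  have hreg := ((hc.comp hw).comp hp).sub ((hc.comp hw).comp hm)
  have htan : HasDerivAt (fun y => Real.tan (angleShift L s y / 2))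
      (1 / Real.cos (angleShift L s 0 / 2) ^ 2 * (-Real.sin (s + angleShift L s 0) ^ 2 / L / 2))
      0 := by
    have hcos : Real.cos (angleShift L s 0 / 2) ≠ 0 := by rw [hw0]; simp
    exact HasDerivAt.comp (h := fun y => angleShift L s y / 2) (0 : ℝ) (Real.hasDerivAt_tan hcos) (hd.div_const 2)
  have hlog := tendsto_log_sub_log_neg htan (by simp [hw0])
    (mul_ne_zero (by simp [hw0]) (div_ne_zero hne two_ne_zero))
  have hlog' := ((Complex.continuous_ofReal.tendsto 0).comp hlog).const_mul
    (Complex.I * (2 * (n : ℂ) + 1))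
  have := (hreg.add hlog').const_mul (-((Real.sin s : ℂ) ^ 2 / L) * expNeg s ^ (2 * n + 1))
  rw [sub_self, Complex.ofReal_zero, mul_zero, add_zero, mul_zero] at this
  refine this.congr fun ε => ?_
  simp only [Function.comp, linePrimitive, circlePrimitive]
  push_cast
  ring

theorem hasPVIntegral_expFun {L s : ℝ} (hL : 0 < L) (hs : s ∈ Ioo 0 Real.pi) (n : ℕ) :
    HasPVIntegral
      (fracLaplacianIntegrand 1 (pullback L (expFun (-(2 * (n : ℤ) + 1)))) (L * Real.cot s))
      (-((Real.sin s : ℂ) ^ 2 / L) * expNeg s ^ (2 * n + 1)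
        * (circlePrimitive n (-s) - circlePrimitive n (Real.pi - s))) := by
  have hu : pullback L (expFun (-(2 * (n : ℤ) + 1)))
      = fun x => expNeg (arccot (x / L)) ^ (2 * n + 1) :=
    funext fun x => expFun_eq_expNeg_pow n _
  have hcont : Continuous (pullback L (expFun (-(2 * (n : ℤ) + 1)))) := by
    rw [hu]
    have := continuous_arccot
    unfold expNeg
    fun_prop
  have hbound : ∀ x, ‖pullback L (expFun (-(2 * (n : ℤ) + 1))) x‖ ≤ 1 := by
    intro x
    rw [hu, norm_pow, norm_expNeg, one_pow]
  have hsin := (Real.sin_pos_of_mem_Ioo hs).ne'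
  have htop : Tendsto (linePrimitive L s n) atTop
      (𝓝 (-((Real.sin s : ℂ) ^ 2 / L) * expNeg s ^ (2 * n + 1) * circlePrimitive n (0 - s))) :=
    tendsto_linePrimitive n (tendsto_arccot_atTop.comp
      ((tendsto_atTop_add_const_left _ _ tendsto_id).atTop_div_const hL))
      (by rw [zero_sub, Real.sin_neg]; exact neg_ne_zero.2 hsin)
  have hbot : Tendsto (linePrimitive L s n) atBot
      (𝓝 (-((Real.sin s : ℂ) ^ 2 / L) * expNeg s ^ (2 * n + 1)
        * circlePrimitive n (Real.pi - s))) :=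
    tendsto_linePrimitive n (tendsto_arccot_atBot.comp
      ((tendsto_atBot_add_const_left _ _ tendsto_id).atBot_div_const hL))
      (by rw [Real.sin_pi_sub]; exact hsin)
  rw [mul_sub, ← zero_sub s]
  exact hasPVIntegral_of_hasDerivAt
    (fun ε hε => integrableOn_fracLaplacianIntegrand_one hcont hbound _ hε)
    (fun y hy => hasDerivAt_linePrimitive hL.ne' hs n hy) htop hbot
    (tendsto_linePrimitive_sub_neg hL.ne' hs n)

/-- The two endpoints differ by `π`: `cot` is unchanged and `e^{-iw}` changes sign. Hence the
constant terms cancel, while odd powers and `cotPoly` double, and so does the logarithm, since `tan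
((π - s)/2) = cot (s/2)`. -/
theorem circlePrimitive_neg_sub_pi_sub (s : ℝ) (n : ℕ) :
    circlePrimitive n (-s) - circlePrimitive n (Real.pi - s) =
      -2 * ((Real.cos s : ℂ) / (Real.sin s : ℂ)) * (expNeg s)⁻¹ ^ (2 * n + 1)
        + 2 * Complex.I * (2 * n + 1)
          * (cotPoly n (expNeg s)⁻¹ - (Real.log (Real.cot (s / 2)) : ℝ)) := by
  have h1 : expNeg (-s) = (expNeg s)⁻¹ := by
    rw [expNeg, expNeg, ← Complex.exp_neg]
    congr 1
    push_cast
    ring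
  have h2 : expNeg (Real.pi - s) = -(expNeg s)⁻¹ := by
    rw [sub_eq_add_neg, expNeg_add, h1, expNeg_eq]
    simp
  have h3 : Real.log (Real.tan (-s / 2)) = -Real.log (Real.cot (s / 2)) := by
    rw [neg_div, Real.tan_neg, Real.log_neg_eq_log, ← Real.tan_inv_eq_cot, Real.log_inv, neg_neg]
  have h4 : Real.tan ((Real.pi - s) / 2) = Real.cot (s / 2) := by
    rw [sub_div, Real.tan_pi_div_two_sub, Real.tan_inv_eq_cot]
  rw [circlePrimitive, circlePrimitive, circlePrimitiveReg, circlePrimitiveReg, h1, h2, h3, h4,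
    cotPoly_neg, Odd.neg_pow ⟨n, rfl⟩, Real.cos_neg, Real.sin_neg, Real.cos_pi_sub, Real.sin_pi_sub]
  push_cast
  ring

/-- The half Laplacian of `e^{-i(2n+1)s}`. -/
theorem halfLaplacianS_expFun {L s : ℝ} (hL : 0 < L) (hs : s ∈ Ioo 0 Real.pi) (n : ℕ) :
    halfLaplacianS L (expFun (-(2 * (n : ℤ) + 1))) s =
      2 * Complex.I / (L * Real.pi) *
        (1 / (2 * n + 3)
          - ∑ l ∈ Finset.range (n + 1), (8 * (n : ℂ) + 4) /
              ((2 * ((l : ℂ) - n) - 3) * (2 * ((l : ℂ) - n) - 1) * (2 * ((l : ℂ) - n) + 1))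
              * expNeg s ^ (2 * l)
          + ((Real.cos s + Real.sin s ^ 2 * Real.log (Real.cot (s / 2)) : ℝ) : ℂ)
            * ((2 * n + 1) * expNeg s ^ (2 * n + 1))) := by
  have hL' : (L : ℂ) ≠ 0 := by exact_mod_cast hL.ne'
  have hpi : (Real.pi : ℂ) ≠ 0 := by exact_mod_cast Real.pi_ne_zero
  have hsin : (Real.sin s : ℂ) ≠ 0 := by exact_mod_cast (Real.sin_pos_of_mem_Ioo hs).ne'
  have hcs : (Real.cos s : ℂ) ^ 2 + (Real.sin s : ℂ) ^ 2 = 1 := by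
    exact_mod_cast Real.cos_sq_add_sin_sq s
  have hz : expNeg s ≠ 0 := Complex.exp_ne_zero _
  have hinv : (expNeg s)⁻¹ = (Real.cos s : ℂ) + Complex.I * (Real.sin s : ℂ) := by
    rw [inv_eq_iff_eq_inv, eq_comm, inv_eq_iff_eq_inv, eq_comm]
    refine inv_eq_of_mul_eq_one_right ?_
    rw [expNeg_eq]
    linear_combination hcs - (Real.sin s : ℂ) ^ 2 * Complex.I_sq
  have hsum : ∑ l ∈ Finset.range (n + 1), (8 * (n : ℂ) + 4) /
        ((2 * ((l : ℂ) - n) - 3) * (2 * ((l : ℂ) - n) - 1) * (2 * ((l : ℂ) - n) + 1))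
        * expNeg s ^ (2 * l)
      = -(2 * n + 1) * expNeg s ^ (2 * n + 1) * ∑ j ∈ Finset.range (n + 1),
        4 * (expNeg s)⁻¹ ^ (2 * j + 1) / ((2 * (j : ℂ) - 1) * (2 * j + 1) * (2 * j + 3)) := by
    -- Reversing the sum, `j = n - l`, makes the coefficients independent of `n`.
    rw [← Finset.sum_range_reflect, Finset.mul_sum]
    refine Finset.sum_congr rfl fun j hj => ?_
    have hj' : j ≤ n := Nat.lt_succ_iff.1 (Finset.mem_range.1 hj)
    obtain ⟨m, rfl⟩ := Nat.exists_eq_add_of_le hj'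
    rw [show j + m + 1 - 1 - j = m by omega, show 2 * (j + m) + 1 = (2 * j + 1) + 2 * m by ring,
      pow_add, inv_pow]
    push_cast
    rw [show 2 * ((m : ℂ) - (j + m)) - 3 = -(2 * j + 3) by ring,
      show 2 * ((m : ℂ) - (j + m)) - 1 = -(2 * j + 1) by ring,
      show 2 * ((m : ℂ) - (j + m)) + 1 = -(2 * j - 1) by ring]
    have hp := pow_ne_zero (2 * j + 1) hz
    rw [show (-(2 * (j : ℂ) + 3)) * -(2 * j + 1) * -(2 * j - 1)
      = -((2 * (j : ℂ) - 1) * (2 * j + 1) * (2 * j + 3)) by ring, div_neg]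
    -- The product occurs only as a common denominator, so it can stay opaque and need not be shown
    -- nonzero.
    generalize (2 * (j : ℂ) - 1) * (2 * j + 1) * (2 * j + 3) = D
    field_simp
    ring
  -- Taken at `z = e^{is}`, the closed form yields `-sin² s · cotPoly n z`, matching the boundary
  -- term; its last two terms cancel the `1 / (2n + 3)` and the isolated `cos s` of the claim.
  rw [hsum, sum_closed_form n (inv_ne_zero hz), halfLaplacianS, fracLaplacian,
    (hasPVIntegral_expFun hL hs n).pvIntegral_eq, circlePrimitive_neg_sub_pi_sub s,
    fracLaplacianConst_one]
  have hk := two_mul_natCast_add_one_ne_zero n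
  have hk3 := two_mul_natCast_add_three_ne_zero n
  have hinvinv : (expNeg s)⁻¹⁻¹ = (Real.cos s : ℂ) - Complex.I * (Real.sin s : ℂ) := by
    rw [inv_inv, expNeg_eq]
  have hdiff : (expNeg s)⁻¹ ^ 2 - ((expNeg s)⁻¹ ^ 2)⁻¹
      = 4 * Complex.I * Real.cos s * Real.sin s := by
    rw [← inv_pow, hinvinv, hinv]
    ring
  have hadd : (expNeg s)⁻¹ ^ 2 - 2 + ((expNeg s)⁻¹ ^ 2)⁻¹ = -4 * (Real.sin s : ℂ) ^ 2 := by
    rw [← inv_pow, hinvinv, hinv]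
    linear_combination 2 * hcs + 2 * (Real.sin s : ℂ) ^ 2 * Complex.I_sq
  have hcos : (expNeg s)⁻¹ + (expNeg s)⁻¹⁻¹ = 2 * Real.cos s := by
    rw [hinvinv, hinv]
    ring
  rw [hdiff, hadd, hcos, inv_pow]
  have hp := pow_ne_zero (2 * n + 1) hz
  push_cast [-Complex.ofReal_sin, -Complex.ofReal_cos]
  generalize (Real.sin s : ℂ) = S at *
  generalize (Real.cos s : ℂ) = C at *
  generalize (expNeg s) ^ (2 * n + 1) = E at *
  generalize cotPoly n (expNeg s)⁻¹ = p at *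
  field_simp
  rw [← sub_eq_zero]
  ring_nf
  simp only [Complex.I_sq]
  ring

/-! ### The cyclic convolution -/

theorem bTilde_of_lt {M P : ℕ} (a : ℕ → ℂ) {n : ℕ} (hn : n < P) :
    bTilde M P a n = if n ≤ M then (8 * (n : ℂ) + 4) * a n else 0 := by
  rw [bTilde, Int.emod_eq_of_lt (by omega) (by omega)]
  simp

/-- The differences `l - n` lie in `[-M, M]`, whose members are distinct modulo `P`. Negative ones
reduce to residues at least `P - M`, positive ones to residues at most `M ≤ P - M - 1`, where the
sequence vanishes. -/
theorem cTilde_sub {M P : ℕ} (hP : 2 * M + 1 ≤ P) {l n : ℕ} (hl : l ≤ M) (hn : n ≤ M) :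
    cTilde M P ((l : ℤ) - n) = if l ≤ n then
      1 / ((2 * ((l : ℂ) - n) - 3) * (2 * ((l : ℂ) - n) - 1) * (2 * ((l : ℂ) - n) + 1)) else 0 := by
  rcases lt_trichotomy l n with h | rfl | h
  · have hmod : ((l : ℤ) - n) % P = l - n + P := by
      rw [← Int.add_emod_right, Int.emod_eq_of_lt (by omega) (by omega)]
    rw [cTilde, hmod, cTildeBase, if_neg (by omega), if_neg (by omega), if_pos h.le]
    push_cast
    simp only [add_sub_cancel_right]
  -- The separate entry `1/3` is the general formula at difference `0`: `1 / ((-3)(-1)(1))`.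
  · rw [if_pos le_rfl, cTilde, sub_self, Int.zero_emod, cTildeBase, if_pos rfl]
    norm_num
  · rw [if_neg (by omega), cTilde, Int.emod_eq_of_lt (by omega) (by omega), cTildeBase,
      if_neg (by omega), if_pos (by omega)]

/-- The cyclic convolution with period `P ≥ 2M + 1` is free of aliasing. -/
theorem cyclicConv_bTilde_cTilde {M P : ℕ} (hP : 2 * M + 1 ≤ P) (a : ℕ → ℂ) {l : ℕ} (hl : l ≤ M) :
    cyclicConv P (bTilde M P a) (cTilde M P) l =
      ∑ n ∈ Finset.range (M + 1), if l ≤ n then a n * ((8 * (n : ℂ) + 4) /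
        ((2 * ((l : ℂ) - n) - 3) * (2 * ((l : ℂ) - n) - 1) * (2 * ((l : ℂ) - n) + 1))) else 0 := by
  rw [cyclicConv]
  refine (Finset.sum_subset (Finset.range_subset_range.2 (by omega : M + 1 ≤ P)) ?_).symm.trans
    (Finset.sum_congr rfl fun n hn => ?_)
  · intro n hn hn'
    simp only [Finset.mem_range] at hn hn'
    rw [bTilde_of_lt a hn, if_neg (by omega), zero_mul]
  · simp only [Finset.mem_range] at hn
    rw [bTilde_of_lt a (by omega), if_pos (by omega), cTilde_sub hP hl (by omega)]
    split_ifs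
    · ring
    · rw [mul_zero]

end HalfLaplacian

/-! ### Summation over the modes -/

open HalfLaplacian in
theorem mainTheorem6 (L : ℝ) (hL : 0 < L) (M P : ℕ) (hP : 2 * M + 1 ≤ P) (a : ℕ → ℂ)
    (s : ℝ) (hs : s ∈ Set.Ioo 0 Real.pi) :
    (∀ l ∈ Finset.range (M + 1),
      HalfLaplacian.HalfLaplacianSExistsAt L (HalfLaplacian.expFun (-(2 * (l : ℤ) + 1))) s) ∧
    ∑ l ∈ Finset.range (M + 1),
        a l * HalfLaplacian.halfLaplacianS L (HalfLaplacian.expFun (-(2 * (l : ℤ) + 1))) s =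
      2 * Complex.I / (L * Real.pi) * ∑ l ∈ Finset.range (M + 1), a l / (2 * (l : ℂ) + 3)
      - 2 * Complex.I / (L * Real.pi) * ∑ l ∈ Finset.range (M + 1),
          HalfLaplacian.cyclicConv P (HalfLaplacian.bTilde M P a) (HalfLaplacian.cTilde M P) l
            * Complex.exp (-(Complex.I * 2 * l * s))
      + 2 * Complex.I / (L * Real.pi)
        * ((Real.cos s + Real.sin s ^ 2 * Real.log (Real.cot (s / 2)) : ℝ) : ℂ)
        * ∑ l ∈ Finset.range (M + 1),
            (2 * (l : ℂ) + 1) * a l * Complex.exp (-(Complex.I * (2 * l + 1) * s)) := by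
  refine ⟨fun l _ => ⟨_, hasPVIntegral_expFun hL hs l⟩, ?_⟩
  have hexp : ∀ l : ℕ, Complex.exp (-(Complex.I * 2 * l * s)) = expNeg s ^ (2 * l) := by
    intro l
    rw [expNeg_pow]
    push_cast
    rw [← mul_assoc]
  have hexp' : ∀ l : ℕ,
      Complex.exp (-(Complex.I * (2 * l + 1) * s)) = expNeg s ^ (2 * l + 1) := by
    intro l
    rw [expNeg_pow]
    push_cast
    rfl
  have hconv : ∑ l ∈ Finset.range (M + 1), cyclicConv P (bTilde M P a) (cTilde M P) l
        * Complex.exp (-(Complex.I * 2 * l * s))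
      = ∑ n ∈ Finset.range (M + 1), a n * ∑ l ∈ Finset.range (n + 1), (8 * (n : ℂ) + 4) /
          ((2 * ((l : ℂ) - n) - 3) * (2 * ((l : ℂ) - n) - 1) * (2 * ((l : ℂ) - n) + 1))
          * expNeg s ^ (2 * l) := by
    have h1 : ∀ l ∈ Finset.range (M + 1), cyclicConv P (bTilde M P a) (cTilde M P) l
          * Complex.exp (-(Complex.I * 2 * l * s))
        = ∑ n ∈ Finset.range (M + 1), if l ≤ n then a n * ((8 * (n : ℂ) + 4) /
          ((2 * ((l : ℂ) - n) - 3) * (2 * ((l : ℂ) - n) - 1) * (2 * ((l : ℂ) - n) + 1))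
          * expNeg s ^ (2 * l)) else 0 := by
      intro l hl
      rw [cyclicConv_bTilde_cTilde hP a (Nat.lt_succ_iff.1 (Finset.mem_range.1 hl)), hexp,
        Finset.sum_mul]
      refine Finset.sum_congr rfl fun n _ => ?_
      rw [ite_mul, zero_mul, mul_assoc]
    -- Swapping the sums over the triangle `l ≤ n ≤ M` groups the terms by mode, as in the
    -- single-mode formula.
    rw [Finset.sum_congr rfl h1, Finset.sum_comm]
    refine Finset.sum_congr rfl fun n hn => ?_
    rw [Finset.mul_sum, ← Finset.sum_filter]
    refine Finset.sum_congr ?_ fun _ _ => rfl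
    ext l
    simp only [Finset.mem_filter, Finset.mem_range] at hn ⊢
    omega
  rw [hconv, Finset.mul_sum, Finset.mul_sum, Finset.mul_sum, ← Finset.sum_sub_distrib,
    ← Finset.sum_add_distrib]
  refine Finset.sum_congr rfl fun n _ => ?_
  rw [halfLaplacianS_expFun hL hs, hexp']
  ring
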